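/- Let $\mathcal A$ be a finite alphabet and $\mathcal F\subseteq\mathcal A$ (possibly empty). Let $L$ be a language on $\mathcal A$, i.e. a set of finite words over $\mathcal A$ that contains the empty word, is closed under deleting the first or the last letter of a word, and is such that for every $v\in L$ there are $a,b\in\mathcal A$ with $av\in L$ and $vb\in L$; assume that every letter of $\mathcal A$ belongs to $L$. Then the following are equivalent. (1) $L$ is the natural coding of an $\mathcal F$-flipped generalized interval exchange transformation. That is, there are nonempty pairwise disjoint open intervals $I_e$, $e\in\mathcal A$, the union of whose closures is $[0,1]$, and a map $T:\bigcup_e I_e\to\mathbb R$ that is continuous and strictly increasing on $I_e$ for $e\notin\mathcal F$ and continuous and strictly decreasing on $I_e$ for $e\in\mathcal F$, such that the $TI_e$, $e\in\mathcal A$, are pairwise disjoint open intervals the union of whose closures is $[0,1]$, and such that $L$ is the set of all finite factors of the trajectories of $T$, namely of the sequences $(u_n)_{n\in\mathbb Z}\in\mathcal A^{\mathbb Z}$ for which there is a point $x$ with $T^nx$ defined and $T^nx\in I_{u_n}$ for every $n\in\mathbb Z$. (2) $L$ satisfies an $\mathcal F$-flipped order condition. That is, there are two total orders on $\mathcal A$,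 with strict orders $<_A$ and $<_D$, such that for every bispecial word $w$ of $L$ (a word $w\in L$ such that at least two letters $x$ satisfy $xw\in L$ and at least two letters $y$ satisfy $wy\in L$), whenever $awc$ and $bwd$ are in $L$ with letters $a\neq b$ and $c\neq d$, one has $a<_A b$ if and only if $c<_{D,w}d$. Here $<_{D,w}$ is $<_D$ if the number of occurrences in $w$ of letters of $\mathcal F$ is even, and the reverse order of $<_D$ if this number is odd. -/

import Mathlib

open Set

namespace IET

/-- A set `L` of finite words is a (factorial, extendable) language: it contains the empty word,
it is stable under removing the first or the last letter, and every word of `L` can be extended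
in `L` by a letter on the left and by a letter on the right. -/
structure IsFactorialExtendable {A : Type*} (L : Language A) : Prop where
  nil_mem : [] ∈ L
  tail_mem : ∀ (a : A) (u : List A), a :: u ∈ L → u ∈ L
  init_mem : ∀ (u : List A) (b : A), u ++ [b] ∈ L → u ∈ L
  extend_left : ∀ v ∈ L, ∃ a : A, a :: v ∈ L
  extend_right : ∀ v ∈ L, ∃ b : A, v ++ [b] ∈ L

/-- The arrival set of `w`: the letters `x` such that `xw` is in `L`. -/
def arrivalSet {A : Type*} (L : Language A) (w : List A) : Set A := {x | x :: w ∈ L}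

/-- The departure set of `w`: the letters `x` such that `wx` is in `L`. -/
def departureSet {A : Type*} (L : Language A) (w : List A) : Set A := {x | w ++ [x] ∈ L}

/-- A word of `L` is bispecial if it has at least two left and at least two right extensions
by letters. -/
def IsBispecial {A : Type*} (L : Language A) (w : List A) : Prop :=
  w ∈ L ∧ (arrivalSet L w).Nontrivial ∧ (departureSet L w).Nontrivial

/-- The requirement made on a word `w` by the (strict) orders `ltA`, `ltD`: if `awc` and `bwd` are
in `L` with `a ≠ b` and `c ≠ d`, then `a` is before `b` for `ltA` iff `c` is before `d` for
`ltD`. -/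
def OrderConditionAt {A : Type*} (L : Language A) (w : List A) (ltA ltD : A → A → Prop) : Prop :=
  ∀ a b c d : A, a ≠ b → c ≠ d → a :: (w ++ [c]) ∈ L → b :: (w ++ [d]) ∈ L →
    (ltA a b ↔ ltD c d)

open Classical in
/-- The number of occurrences in `w` of letters belonging to `F`. -/
noncomputable def flipCount {A : Type*} (F : Set A) (w : List A) : ℕ :=
  w.countP (fun a => decide (a ∈ F))

open Classical in
/-- The order `<_{D,w}`: it is `ltD` if `w` has an even number of occurrences of letters of `F`,
and the reverse of `ltD` otherwise. -/
def departureOrder {A : Type*} (F : Set A) (ltD : A → A → Prop) (w : List A) : A → A → Prop :=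
  if Even (flipCount F w) then ltD else fun c d => ltD d c

/-- The `F`-flipped order condition: there are two total orders on the alphabet (given by their
strict orders) such that every bispecial word `w` satisfies the order condition for `<_A` and
`<_{D,w}`. -/
def FlippedOrderCondition {A : Type*} (F : Set A) (L : Language A) : Prop :=
  ∃ ltA ltD : A → A → Prop, IsStrictTotalOrder A ltA ∧ IsStrictTotalOrder A ltD ∧
    ∀ w : List A, IsBispecial L w → OrderConditionAt L w ltA (departureOrder F ltD w)

/-- An `F`-flipped generalized interval exchange transformation, given together with its defining
intervals `I_e = (left e, right e)`, `e ∈ A`. The map is defined on the union of the defining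
intervals; the values of `toFun` elsewhere are irrelevant and never used. -/
structure GenIET {A : Type*} (F : Set A) where
  toFun : ℝ → ℝ
  left : A → ℝ
  right : A → ℝ
  left_lt_right : ∀ e, left e < right e
  disjoint_intervals : Pairwise fun e f : A =>
    Disjoint (Ioo (left e) (right e)) (Ioo (left f) (right f))
  iUnion_closure : ⋃ e, closure (Ioo (left e) (right e)) = Icc (0 : ℝ) 1
  continuousOn : ∀ e, ContinuousOn toFun (Ioo (left e) (right e))
  strictMonoOn : ∀ e ∉ F, StrictMonoOn toFun (Ioo (left e) (right e))
  strictAntiOn : ∀ e ∈ F, StrictAntiOn toFun (Ioo (left e) (right e))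
  image_interval : ∀ e, ∃ c d : ℝ, toFun '' Ioo (left e) (right e) = Ioo c d
  disjoint_images : Pairwise fun e f : A =>
    Disjoint (toFun '' Ioo (left e) (right e)) (toFun '' Ioo (left f) (right f))
  iUnion_closure_image : ⋃ e, closure (toFun '' Ioo (left e) (right e)) = Icc (0 : ℝ) 1

namespace GenIET

variable {A : Type*} {F : Set A}

/-- The defining interval `I_e`. -/
def interval (T : GenIET F) (e : A) : Set ℝ := Ioo (T.left e) (T.right e)

/-- `u` is a trajectory of `T`: there is a two-sided orbit `(x n)` with `x n = T^n (x 0)`, contained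
in the domain of `T`, such that `u n` is the letter of the defining interval containing `x n`. -/
def IsTrajectory (T : GenIET F) (u : ℤ → A) : Prop :=
  ∃ x : ℤ → ℝ, ∀ n : ℤ, x n ∈ T.interval (u n) ∧ x (n + 1) = T.toFun (x n)

end GenIET

/-- The finite word `w` is a factor of the two-sided sequence `u`. -/
def IsFactor {A : Type*} (w : List A) (u : ℤ → A) : Prop :=
  ∃ k : ℤ, ∀ (i : ℕ) (hi : i < w.length), w[i] = u (k + i)

/-- The natural coding `L(T)`: the set of all factors of the trajectories of `T`. -/
def GenIET.naturalCoding {A : Type*} {F : Set A} (T : GenIET F) : Language A :=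
  ({w | ∃ u : ℤ → A, T.IsTrajectory u ∧ IsFactor w u} : Set (List A))

end IET

/-!
Given a transformation `T`, order the letters by the positions of the intervals `T I_e` for `<_A`
and by those of the intervals `I_e` for `<_D`. Two orbits following a word `w` keep or exchange
their order after `|w|` steps according to the parity of the number of flips in `w`
(`GenIET.orbit_lt_iff`). If `awc` and `bwd` are followed by two orbits, the position of the orbits
when they enter `w` is that of `T I_a` and `T I_b`, and their position when they leave it is that of
`I_c` and `I_d`; this is the order condition.

Conversely, every word of `L` is a factor of a two-sided sequence all of whose factors are in `L`.
Choosing one sequence for each word gives a countable shift-invariant set `Y` of sequences. Order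
two-sided sequences by a signed lexicographic order (`SeqLT`): look at the first difference in the
futures, compare the letters there by `<_D`, and reverse the result if the number of flips before
the difference is odd; if the futures are equal, do the same in the pasts with `<_A`. For this order
the sequences with `e` at index `0` form pieces ordered by `<_D`, and the shift preserves or
reverses the order on each piece as prescribed by `F`. The order condition is what makes the images
of the pieces ordered by `<_A` (`seqLT_seqShift_of_arrival`). Thus the shift on `Y` is an exchange
of pieces of a linear order (`IsOrderedExchange`).

To pass to `[0, 1]`, give the points of `Y` positive weights of sum `1` and replace each point `y`
by an open interval `J_y` of that length, in the order of `Y`. The `J_y` are dense in `[0, 1]`, and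
the map sending each `J_y` affinely onto the interval of the shifted sequence extends to a
homeomorphism from each `I_e` onto its image; it is written explicitly as a sum of ramps
(`stretch`). The midpoints of the `J_y` have the sequences of `Y` as trajectories. A word followed
by any orbit of `T` is followed on an open set of points, which meets some `J_y`, so it is already
a factor of a sequence of `Y` and belongs to `L`. This is `IsOrderedExchange.exists_genIET`.
-/

namespace IET


/-! ### From an interval exchange to the order condition -/

lemma lt_iff_left_lt_of_disjoint {A : Type*} {l r : A → ℝ}
    (hd : Pairwise fun e f : A => Disjoint (Ioo (l e) (r e)) (Ioo (l f) (r f)))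
    {a b : A} (hab : a ≠ b) {x y : ℝ} (hx : x ∈ Ioo (l a) (r a)) (hy : y ∈ Ioo (l b) (r b)) :
    l a < l b ↔ x < y := by
  have h : Disjoint (Ioo (l a) (r a)) (Ioo (l b) (r b)) := hd hab
  rw [Set.Ioo_disjoint_Ioo] at h
  obtain ⟨hx1, hx2⟩ := hx
  obtain ⟨hy1, hy2⟩ := hy
  rcases min_le_iff.1 h with h | h <;> rcases le_max_iff.1 h with h | h <;>
    constructor <;> intro <;> linarith

lemma left_injective_of_disjoint {A : Type*} {l r : A → ℝ} (hlr : ∀ e, l e < r e)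
    (hd : Pairwise fun e f : A => Disjoint (Ioo (l e) (r e)) (Ioo (l f) (r f))) :
    Function.Injective l := by
  intro a b hab
  by_contra hne
  have h : Disjoint (Ioo (l a) (r a)) (Ioo (l b) (r b)) := hd hne
  rw [Set.Ioo_disjoint_Ioo] at h
  have ha := hlr a
  have hb := hlr b
  rcases min_le_iff.1 h with h | h <;> rcases le_max_iff.1 h with h | h <;> linarith

lemma isStrictTotalOrder_of_injective {A B : Type*} [LinearOrder B] {l : A → B}
    (hl : Function.Injective l) : IsStrictTotalOrder A (fun a b => l a < l b) :=
  RelEmbedding.isStrictTotalOrder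
    (⟨⟨l, hl⟩, Iff.rfl⟩ : (fun a b => l a < l b) ↪r ((· < ·) : B → B → Prop))

open Classical in
lemma flipCount_cons {A : Type*} (F : Set A) (a : A) (w : List A) :
    flipCount F (a :: w) = flipCount F w + if a ∈ F then 1 else 0 := by
  simp [flipCount, List.countP_cons]

/-- Along two orbits following the same word `w`, the order of the points is preserved after
`|w|` steps if `w` has an even number of flips, and reversed otherwise. -/
lemma GenIET.orbit_lt_iff {A : Type*} {F : Set A} (T : GenIET F) (w : List A) :
    ∀ x y : ℕ → ℝ,
      (∀ (i : ℕ) (hi : i < w.length), x i ∈ T.interval w[i] ∧ x (i + 1) = T.toFun (x i)) →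
      (∀ (i : ℕ) (hi : i < w.length), y i ∈ T.interval w[i] ∧ y (i + 1) = T.toFun (y i)) →
      (Even (flipCount F w) → (x 0 < y 0 ↔ x w.length < y w.length)) ∧
      (¬ Even (flipCount F w) → (x 0 < y 0 ↔ y w.length < x w.length)) := by
  induction w with
  | nil => intro x y _ _; simp [flipCount]
  | cons a w ih =>
    intro x y hx hy
    have hx0 := hx 0 (by simp)
    have hy0 := hy 0 (by simp)
    simp only [List.getElem_cons_zero, zero_add] at hx0 hy0
    have hx' : ∀ (i : ℕ) (hi : i < w.length),
        x (i + 1) ∈ T.interval w[i] ∧ x (i + 1 + 1) = T.toFun (x (i + 1)) :=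
      fun i hi => hx (i + 1) (by simpa using hi)
    have hy' : ∀ (i : ℕ) (hi : i < w.length),
        y (i + 1) ∈ T.interval w[i] ∧ y (i + 1 + 1) = T.toFun (y (i + 1)) :=
      fun i hi => hy (i + 1) (by simpa using hi)
    have ih1 := ih (fun i => x (i + 1)) (fun i => y (i + 1)) hx' hy'
    have ih2 := ih (fun i => y (i + 1)) (fun i => x (i + 1)) hy' hx'
    simp only [zero_add] at ih1 ih2
    rw [flipCount_cons, List.length_cons]
    by_cases ha : a ∈ F
    · have h := (T.strictAntiOn a ha).lt_iff_gt hy0.1 hx0.1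
      rw [← hx0.2, ← hy0.2] at h
      simp only [ha, if_true, Nat.even_add_one, not_not]
      exact ⟨fun hw => h.symm.trans (ih2.2 hw), fun hw => h.symm.trans (ih2.1 hw)⟩
    · have h := (T.strictMonoOn a ha).lt_iff_lt hx0.1 hy0.1
      rw [← hx0.2, ← hy0.2] at h
      simp only [ha, if_false, add_zero]
      exact ⟨fun hw => h.symm.trans (ih1.1 hw), fun hw => h.symm.trans (ih1.2 hw)⟩

/-- The letters are ordered by the positions of the intervals `T I_e` for `<_A`, and by those of
the intervals `I_e` for `<_D`. -/
lemma GenIET.flippedOrderCondition {A : Type*} {F : Set A} (T : GenIET F) :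
    FlippedOrderCondition F T.naturalCoding := by
  choose l r hlr using T.image_interval
  have hd := T.disjoint_images
  simp only [hlr] at hd
  have hpos : ∀ e, l e < r e := by
    intro e
    have : (T.toFun '' Ioo (T.left e) (T.right e)).Nonempty :=
      (nonempty_Ioo.2 (T.left_lt_right e)).image _
    rwa [hlr, nonempty_Ioo] at this
  refine ⟨_, _, isStrictTotalOrder_of_injective (left_injective_of_disjoint hpos hd),
    isStrictTotalOrder_of_injective
      (left_injective_of_disjoint T.left_lt_right T.disjoint_intervals), ?_⟩
  rintro w - a b c d hab hcd ⟨u, ⟨x, hx⟩, k, hu⟩ ⟨v, ⟨y, hy⟩, j, hv⟩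
  have key : ∀ (e f : A) (u : ℤ → A) (x : ℤ → ℝ) (k : ℤ),
      (∀ n : ℤ, x n ∈ T.interval (u n) ∧ x (n + 1) = T.toFun (x n)) →
      (∀ (i : ℕ) (hi : i < (e :: (w ++ [f])).length), (e :: (w ++ [f]))[i] = u (k + i)) →
      x (k + 1) ∈ Ioo (l e) (r e) ∧ x (k + 1 + w.length) ∈ Ioo (T.left f) (T.right f) ∧
      ∀ (i : ℕ) (hi : i < w.length), x (k + 1 + i) ∈ T.interval w[i] ∧
        x (k + 1 + (i + 1 : ℕ)) = T.toFun (x (k + 1 + i)) := by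
    intro e f u x k hx hu
    refine ⟨?_, ?_, ?_⟩
    · rw [← hlr e, (hx k).2]
      refine mem_image_of_mem _ ?_
      have := hu 0 (by simp)
      simp only [List.getElem_cons_zero, Nat.cast_zero, add_zero] at this
      rw [this]
      exact (hx k).1
    · have := hu (w.length + 1) (by simp)
      simp only [List.getElem_cons_succ, List.getElem_concat_length] at this
      have h2 : k + 1 + (w.length : ℤ) = k + ((w.length + 1 : ℕ) : ℤ) := by push_cast; ring
      rw [h2, this]
      exact (hx _).1
    · intro i hi
      have := hu (i + 1) (by simp; omega)
      simp only [List.getElem_cons_succ, List.getElem_append_left hi] at this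
      have h2 : k + 1 + (i : ℤ) = k + ((i + 1 : ℕ) : ℤ) := by push_cast; ring
      refine ⟨?_, ?_⟩
      · rw [this, h2]; exact (hx _).1
      · rw [← (hx _).2]; congr 1; push_cast; ring
  obtain ⟨hx1, hx2, hx3⟩ := key a c u x k hx hu
  obtain ⟨hy1, hy2, hy3⟩ := key b d v y j hy hv
  have h := T.orbit_lt_iff w (fun i => x (k + 1 + i)) (fun i => y (j + 1 + i)) hx3 hy3
  simp only [Nat.cast_zero, add_zero] at h
  refine (lt_iff_left_lt_of_disjoint hd hab hx1 hy1).trans ?_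
  unfold departureOrder
  split_ifs with hw
  · exact (h.1 hw).trans (lt_iff_left_lt_of_disjoint T.disjoint_intervals hcd hx2 hy2).symm
  · exact (h.2 hw).trans (lt_iff_left_lt_of_disjoint T.disjoint_intervals hcd.symm hy2 hx2).symm


/-! ### Masses of sets of points -/

/-- The total weight of the elements of `s`, for the weights `m`. -/
noncomputable def mass {Y : Type*} (m : Y → ℝ) (s : Set Y) : ℝ := ∑' z, s.indicator m z

section Mass

variable {Y : Type*} {m : Y → ℝ}

lemma mass_union (hs : Summable m) {s t : Set Y} (h : Disjoint s t) :
    mass m (s ∪ t) = mass m s + mass m t := by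
  unfold mass
  rw [indicator_union_of_disjoint h]
  exact (hs.indicator s).tsum_add (hs.indicator t)

lemma mass_mono (hm : ∀ y, 0 < m y) (hs : Summable m) {s t : Set Y} (h : s ⊆ t) :
    mass m s ≤ mass m t :=
  (hs.indicator s).tsum_le_tsum
    (fun z => indicator_le_indicator_of_subset h (fun a => (hm a).le) z) (hs.indicator t)

lemma mass_empty : mass m ∅ = 0 := by simp [mass]

lemma mass_univ : mass m univ = ∑' y, m y := by simp [mass]

lemma mass_singleton (y : Y) : mass m {y} = m y := by
  unfold mass
  rw [tsum_eq_single y fun z hz => by simp [hz]]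
  simp

lemma mass_pos (hm : ∀ y, 0 < m y) (hs : Summable m) {s : Set Y} (h : s.Nonempty) :
    0 < mass m s := by
  obtain ⟨y, hy⟩ := h
  calc 0 < m y := hm y
    _ = mass m {y} := (mass_singleton y).symm
    _ ≤ mass m s := mass_mono hm hs (singleton_subset_iff.2 hy)

lemma mass_comp_equiv {Z : Type*} (S : Y ≃ Z) (m : Z → ℝ) (s : Set Z) :
    mass (m ∘ S) (S ⁻¹' s) = mass m s :=
  S.tsum_eq (s.indicator m)

lemma mass_Iic [LinearOrder Y] (hs : Summable m) (y : Y) :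
    mass m (Iic y) = mass m (Iio y) + m y := by
  rw [← Iio_union_right, mass_union hs (by simp), mass_singleton]

lemma mass_Iic_le_mass_Iio [LinearOrder Y] (hm : ∀ y, 0 < m y) (hs : Summable m) {y z : Y}
    (h : y < z) : mass m (Iic y) ≤ mass m (Iio z) :=
  mass_mono hm hs (Iic_subset_Iio.2 h)

/-- The weights are positive with sum `1`, so the intervals given to the points fill `[0, 1]` up to
a null set; hence they meet every open subinterval. -/
lemma exists_mem_Ioo_mass [LinearOrder Y] [Countable Y] (hm : ∀ y, 0 < m y) (h1 : HasSum m 1)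
    {a b : ℝ} (ha : 0 ≤ a) (hab : a < b) (hb : b ≤ 1) :
    ∃ y : Y, ∃ x ∈ Ioo a b, x ∈ Ioo (mass m (Iio y)) (mass m (Iic y)) := by
  by_contra! hcon
  have hs := h1.summable
  set U : Set ℝ := ⋃ y, Ioo (mass m (Iio y)) (mass m (Iic y)) with hU
  have hdisj : Pairwise fun y z : Y => Disjoint (Ioo (mass m (Iio y)) (mass m (Iic y)))
      (Ioo (mass m (Iio z)) (mass m (Iic z))) := by
    intro y z hyz
    rw [Set.Ioo_disjoint_Ioo]
    rcases hyz.lt_or_gt with h | h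
    · exact (min_le_left _ _).trans ((mass_Iic_le_mass_Iio hm hs h).trans (le_max_right _ _))
    · exact (min_le_right _ _).trans ((mass_Iic_le_mass_Iio hm hs h).trans (le_max_left _ _))
  have hvol : MeasureTheory.volume U = 1 := by
    rw [hU, MeasureTheory.measure_iUnion hdisj fun _ => measurableSet_Ioo]
    simp_rw [Real.volume_Ioo, mass_Iic hs, add_sub_cancel_left]
    rw [← ENNReal.ofReal_tsum_of_nonneg (fun y => (hm y).le) hs, h1.tsum_eq, ENNReal.ofReal_one]
  have hsub : U ∪ Ioo a b ⊆ Icc 0 1 := by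
    apply union_subset
    · apply iUnion_subset
      intro y
      refine Ioo_subset_Icc_self.trans (Icc_subset_Icc ?_ ?_)
      · rw [← mass_empty (m := m)]
        exact mass_mono hm hs (empty_subset _)
      · rw [← h1.tsum_eq, ← mass_univ]
        exact mass_mono hm hs (subset_univ _)
    · exact Ioo_subset_Icc_self.trans (Icc_subset_Icc ha hb)
  have hUab : Disjoint U (Ioo a b) := by
    rw [Set.disjoint_left]
    intro x hx hx'
    obtain ⟨y, hy⟩ := mem_iUnion.1 hx
    exact hcon y x hx' hy
  have h := MeasureTheory.measure_mono (μ := MeasureTheory.volume) hsub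
  rw [MeasureTheory.measure_union hUab measurableSet_Ioo, hvol, Real.volume_Ioo, Real.volume_Icc,
    sub_zero, ENNReal.ofReal_one] at h
  have h0 : ENNReal.ofReal (b - a) ≤ 0 :=
    (ENNReal.add_le_add_iff_left ENNReal.one_ne_top).1 (by simpa using h)
  have := ENNReal.ofReal_eq_zero.1 (le_antisymm h0 zero_le)
  linarith

lemma disjoint_level_intervals {A : Type*} (hm : ∀ y, 0 < m y) (hs : Summable m) (c : Y → A)
    {r : A → ℤ} (hr : Function.Injective r) : Pairwise fun e f : A =>
      Disjoint (Ioo (mass m {z | r (c z) < r e}) (mass m {z | r (c z) ≤ r e}))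
        (Ioo (mass m {z | r (c z) < r f}) (mass m {z | r (c z) ≤ r f})) := by
  intro e f hef
  rw [Set.Ioo_disjoint_Ioo]
  rcases (hr.ne hef).lt_or_gt with h | h
  · exact (min_le_left _ _).trans (le_trans
      (mass_mono hm hs fun z (hz : r (c z) ≤ r e) => lt_of_le_of_lt hz h) (le_max_right _ _))
  · exact (min_le_right _ _).trans (le_trans
      (mass_mono hm hs fun z (hz : r (c z) ≤ r f) => lt_of_le_of_lt hz h) (le_max_left _ _))

lemma mass_level_le {A : Type*} (hs : Summable m) (c : Y → A)
    {r : A → ℤ} (hr : Function.Injective r) (e : A) :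
    mass m {z | r (c z) ≤ r e} = mass m {z | r (c z) < r e} + mass m {z | c z = e} := by
  rw [← mass_union hs]
  · congr 1
    ext z
    simp only [mem_ofPred_eq, mem_union, le_iff_lt_or_eq, hr.eq_iff]
  · rw [Set.disjoint_left]
    intro z (hz : r (c z) < r e) (hz' : c z = e)
    exact hz.ne (congrArg r hz')

lemma mass_level_lt_mass_level_le {A : Type*} (hm : ∀ y, 0 < m y) (hs : Summable m) {c : Y → A}
    (hc : Function.Surjective c) {r : A → ℤ} (hr : Function.Injective r) (e : A) :
    mass m {z | r (c z) < r e} < mass m {z | r (c z) ≤ r e} := by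
  rw [mass_level_le hs c hr]
  have := mass_pos hm hs (s := {z | c z = e}) (hc e)
  linarith

lemma iUnion_level_intervals {A : Type*} [Finite A] (hm : ∀ y, 0 < m y) (h1 : HasSum m 1)
    {c : Y → A} (hc : Function.Surjective c) [Nonempty Y] {r : A → ℤ}
    (hr : Function.Injective r) :
    ⋃ e, closure (Ioo (mass m {z | r (c z) < r e}) (mass m {z | r (c z) ≤ r e})) = Icc 0 1 := by
  have hs := h1.summable
  have hone : mass m univ = 1 := by rw [mass_univ, h1.tsum_eq]
  simp_rw [closure_Ioo (mass_level_lt_mass_level_le hm hs hc hr _).ne]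
  apply Subset.antisymm
  · refine iUnion_subset fun e => Icc_subset_Icc ?_ ?_
    · rw [← mass_empty (m := m)]
      exact mass_mono hm hs (empty_subset _)
    · rw [← hone]
      exact mass_mono hm hs (subset_univ _)
  · rintro x ⟨hx0, hx1⟩
    have : Nonempty A := Nonempty.map c inferInstance
    obtain ⟨t, ht⟩ := Finite.exists_max r
    have hne : {e | x ≤ mass m {z | r (c z) ≤ r e}}.Nonempty := by
      refine ⟨t, ?_⟩
      have : {z | r (c z) ≤ r t} = univ := eq_univ_of_forall fun z => ht (c z)
      rw [mem_ofPred_eq, this, hone]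
      exact hx1
    obtain ⟨e, he, hmin⟩ := exists_min_image _ r (toFinite _) hne
    refine mem_iUnion.2 ⟨e, ?_, he⟩
    -- By minimality of `e`, the point cannot lie strictly to the left of its interval.
    by_contra! hlt
    have hne' : {f | r f < r e}.Nonempty := by
      by_contra hemp
      rw [not_nonempty_iff_eq_empty] at hemp
      have : {z | r (c z) < r e} = ∅ := by
        ext z
        have : c z ∉ {f | r f < r e} := by rw [hemp]; exact notMem_empty _
        simpa using this
      rw [this, mass_empty] at hlt
      linarith
    obtain ⟨f, hf, hmax⟩ := exists_max_image _ r (toFinite _) hne'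
    have : {z | r (c z) < r e} = {z | r (c z) ≤ r f} := by
      ext z
      exact ⟨fun hz => hmax (c z) hz, fun (hz : r (c z) ≤ r f) => lt_of_le_of_lt hz hf⟩
    rw [this] at hlt
    exact absurd (hmin f hlt.le) (not_le.2 hf)

end Mass

/-! ### Stretching one interval onto another -/

section Stretch

variable {Y : Type*} [LinearOrder Y] {m n : Y → ℝ}

/-- The affine ramp from `0` to `1` on the interval of the point `z`, constant outside of it. -/
noncomputable def ramp (m : Y → ℝ) (z : Y) (x : ℝ) : ℝ :=
  max 0 (min 1 ((x - mass m (Iio z)) / m z))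

/-- The sum of the ramps of the points of `P`, with heights `n`: it maps the interval of each point
`z` of `P` affinely onto an interval of length `n z`. -/
noncomputable def stretch (m n : Y → ℝ) (P : Set Y) (x : ℝ) : ℝ :=
  ∑' z, P.indicator (fun z => n z * ramp m z x) z

lemma ramp_nonneg (z : Y) (x : ℝ) : 0 ≤ ramp m z x := le_max_left _ _

lemma ramp_le_one (z : Y) (x : ℝ) : ramp m z x ≤ 1 :=
  max_le zero_le_one (min_le_left _ _)

lemma ramp_mono (hm : ∀ y, 0 < m y) (z : Y) : Monotone (ramp m z) := by
  intro x y hxy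
  have := (hm z).le
  unfold ramp
  gcongr

lemma ramp_continuous (z : Y) : Continuous (ramp m z) := by
  unfold ramp
  fun_prop

lemma ramp_eq_zero (hm : ∀ y, 0 < m y) {z : Y} {x : ℝ} (h : x ≤ mass m (Iio z)) :
    ramp m z x = 0 :=
  max_eq_left ((min_le_right _ _).trans
    (div_nonpos_of_nonpos_of_nonneg (by linarith) (hm z).le))

lemma ramp_eq_one (hm : ∀ y, 0 < m y) (hs : Summable m) {z : Y} {x : ℝ}
    (h : mass m (Iic z) ≤ x) : ramp m z x = 1 := by
  rw [mass_Iic hs] at h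
  have h1 : 1 ≤ (x - mass m (Iio z)) / m z := by
    rw [le_div_iff₀ (hm z)]
    linarith
  rw [ramp, min_eq_left h1, max_eq_right zero_le_one]

lemma ramp_add_mul (hm : ∀ y, 0 < m y) {z : Y} {t : ℝ} (ht : t ∈ Ioo (0 : ℝ) 1) :
    ramp m z (mass m (Iio z) + m z * t) = t := by
  rw [ramp, add_sub_cancel_left, mul_div_cancel_left₀ _ (hm z).ne', min_eq_right ht.2.le,
    max_eq_right ht.1.le]

/-- Points of the interval of `y` are parametrized by `t ∈ (0, 1)`. -/
lemma mem_Ioo_mass_iff (hm : ∀ y, 0 < m y) (hs : Summable m) {y : Y} {x : ℝ} :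
    x ∈ Ioo (mass m (Iio y)) (mass m (Iic y)) ↔
      ∃ t ∈ Ioo (0 : ℝ) 1, x = mass m (Iio y) + m y * t := by
  have hy := hm y
  rw [mass_Iic hs]
  constructor
  · rintro ⟨h1, h2⟩
    refine ⟨(x - mass m (Iio y)) / m y, ⟨div_pos (by linarith) hy, ?_⟩, ?_⟩
    · rw [div_lt_one hy]; linarith
    · field_simp; ring
  · rintro ⟨t, ⟨h1, h2⟩, rfl⟩
    constructor <;> nlinarith

lemma summable_stretch (hn : ∀ y, 0 < n y) (hns : Summable n) (P : Set Y) (x : ℝ) :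
    Summable fun z => P.indicator (fun z => n z * ramp m z x) z :=
  Summable.of_nonneg_of_le
    (fun z => indicator_nonneg (fun z _ => mul_nonneg (hn z).le (ramp_nonneg z x)) z)
    (fun z => indicator_le_self' (fun z _ => (hn z).le) z |>.trans' <| indicator_le_indicator <|
      mul_le_of_le_one_right (hn z).le (ramp_le_one z x)) hns

lemma stretch_continuous (hn : ∀ y, 0 < n y) (hns : Summable n) (P : Set Y) :
    Continuous (stretch m n P) := by
  refine continuous_tsum (u := n) (fun z => ?_) hns fun z x => ?_
  · by_cases hz : z ∈ P
    · simp only [indicator_of_mem hz]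
      exact continuous_const.mul (ramp_continuous z)
    · simp only [indicator_of_notMem hz]
      exact continuous_const
  · by_cases hz : z ∈ P
    · rw [indicator_of_mem hz, Real.norm_of_nonneg (mul_nonneg (hn z).le (ramp_nonneg z x))]
      exact mul_le_of_le_one_right (hn z).le (ramp_le_one z x)
    · rw [indicator_of_notMem hz, norm_zero]
      exact (hn z).le

lemma stretch_lt (hm : ∀ y, 0 < m y) (hs : Summable m) (hn : ∀ y, 0 < n y) (hns : Summable n)
    {P : Set Y} {y : Y} (hy : y ∈ P) {a x b : ℝ} (hax : a < x) (hxb : x < b)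
    (hx : x ∈ Ioo (mass m (Iio y)) (mass m (Iic y))) : stretch m n P a < stretch m n P b := by
  refine Summable.tsum_lt_tsum (i := y) (fun z => ?_) ?_ (summable_stretch hn hns P a)
    (summable_stretch hn hns P b)
  · refine indicator_le_indicator (mul_le_mul_of_nonneg_left ?_ (hn z).le)
    exact ramp_mono hm z (hax.trans hxb).le
  · simp only [indicator_of_mem hy]
    refine mul_lt_mul_of_pos_left ?_ (hn y)
    have hym := hm y
    rw [mass_Iic hs] at hx
    obtain ⟨h1, h2⟩ := hx
    have e1 : (a - mass m (Iio y)) / m y < (x - mass m (Iio y)) / m y := by gcongr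
    have e2 : (x - mass m (Iio y)) / m y < (b - mass m (Iio y)) / m y := by gcongr
    have e3 : 0 < (x - mass m (Iio y)) / m y := div_pos (by linarith) hym
    have e4 : (x - mass m (Iio y)) / m y < 1 := by rw [div_lt_one hym]; linarith
    calc ramp m y a ≤ max 0 ((a - mass m (Iio y)) / m y) := max_le_max le_rfl (min_le_right _ _)
      _ < (x - mass m (Iio y)) / m y := max_lt e3 e1
      _ < min 1 ((b - mass m (Iio y)) / m y) := lt_min e4 e2
      _ ≤ ramp m y b := le_max_right _ _

lemma stretch_eq_zero (hm : ∀ y, 0 < m y) {P : Set Y} {x : ℝ}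
    (h : ∀ z ∈ P, x ≤ mass m (Iio z)) : stretch m n P x = 0 := by
  have : ∀ z, P.indicator (fun z => n z * ramp m z x) z = 0 := by
    intro z
    by_cases hz : z ∈ P
    · rw [indicator_of_mem hz, ramp_eq_zero hm (h z hz), mul_zero]
    · exact indicator_of_notMem hz _
  simp [stretch, this]

lemma stretch_eq_mass (hm : ∀ y, 0 < m y) (hs : Summable m) {P : Set Y} {x : ℝ}
    (h : ∀ z ∈ P, mass m (Iic z) ≤ x) : stretch m n P x = mass n P := by
  refine tsum_congr fun z => ?_
  by_cases hz : z ∈ P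
  · rw [indicator_of_mem hz, indicator_of_mem hz, ramp_eq_one hm hs (h z hz), mul_one]
  · rw [indicator_of_notMem hz, indicator_of_notMem hz]

lemma stretch_add_mul (hm : ∀ y, 0 < m y) (hs : Summable m) (hns : Summable n)
    {P : Set Y} {y : Y} (hy : y ∈ P) {t : ℝ} (ht : t ∈ Ioo (0 : ℝ) 1) :
    stretch m n P (mass m (Iio y) + m y * t) = mass n (P ∩ Iio y) + n y * t := by
  have hsum : n y * t = ∑' z, ({y} : Set Y).indicator (fun z => n z * t) z :=
    (mass_singleton (m := fun z => n z * t) y).symm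
  rw [hsum, show mass n (P ∩ Iio y) = ∑' z, (P ∩ Iio y).indicator n z from rfl,
    ← (hns.indicator _).tsum_add ((hns.mul_right t).indicator _)]
  obtain ⟨h1, h2⟩ := (mem_Ioo_mass_iff hm hs).2 ⟨t, ht, rfl⟩
  refine tsum_congr fun z => ?_
  by_cases hz : z ∈ P
  · rw [indicator_of_mem hz]
    rcases lt_trichotomy z y with h | rfl | h
    · rw [ramp_eq_one hm hs ((mass_Iic_le_mass_Iio hm hs h).trans h1.le),
        indicator_of_mem (show z ∈ P ∩ Iio y from ⟨hz, h⟩),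
        indicator_of_notMem (show z ∉ ({y} : Set Y) from h.ne), mul_one, add_zero]
    · rw [ramp_add_mul hm ht, indicator_of_notMem (fun hh => lt_irrefl z hh.2),
        indicator_of_mem (mem_singleton z), zero_add]
    · rw [ramp_eq_zero hm (h2.le.trans (mass_Iic_le_mass_Iio hm hs h)),
        indicator_of_notMem (fun hh => h.asymm hh.2),
        indicator_of_notMem (show z ∉ ({y} : Set Y) from h.ne'), mul_zero, add_zero]
  · rw [indicator_of_notMem hz, indicator_of_notMem (fun hh => hz hh.1),
      indicator_of_notMem (show z ∉ ({y} : Set Y) from fun hh => hz (hh ▸ hy)), add_zero]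

end Stretch


/-! ### Realization of an ordered symbolic system by an interval exchange -/

/-- `S` is a bijection of the linearly ordered set `Y`, partitioned into pieces labelled by `c`,
which acts on the order as an `F`-flipped interval exchange: the pieces are ordered by `rD`, their
images are ordered by `rA`, and `S` is decreasing on the pieces with label in `F` and increasing on
the other pieces. The orders on the labels are encoded by functions with integer values. -/
structure IsOrderedExchange {A Y : Type*} [LinearOrder Y] (F : Set A) (rA rD : A → ℤ)
    (S : Equiv.Perm Y) (c : Y → A) : Prop where
  lt_of_departure : ∀ y z, rD (c y) < rD (c z) → y < z
  lt_of_arrival : ∀ y z, rA (c y) < rA (c z) → S y < S z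
  lt_of_notMem : ∀ y z, c y = c z → c y ∉ F → y < z → S y < S z
  lt_of_mem : ∀ y z, c y = c z → c y ∈ F → y < z → S z < S y

section Realization

variable {A Y : Type*} [LinearOrder Y] {F : Set A} {rA rD : A → ℤ} {S : Equiv.Perm Y} {c : Y → A}
  {m : Y → ℝ}

/-- The left end of the interval of `S y`, computed on the side of `Y` before applying `S`: the
points sent before `S y` have an earlier label for `rA`, or the same label and a smaller position. -/
lemma IsOrderedExchange.mass_Iio_apply (h : IsOrderedExchange F rA rD S c)
    (hrA : Function.Injective rA) (hs : Summable m) {y : Y} (hy : c y ∉ F) :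
    mass m (Iio (S y)) =
      mass (m ∘ S) {z | rA (c z) < rA (c y)} + mass (m ∘ S) ({z | c z = c y} ∩ Iio y) := by
  rw [← mass_union (S.summable_iff.2 hs), ← mass_comp_equiv S]
  · congr 1
    ext z
    simp only [mem_preimage, mem_Iio, mem_union, mem_inter_iff, mem_ofPred_eq]
    constructor
    · intro hz
      rcases lt_trichotomy (rA (c z)) (rA (c y)) with h1 | h1 | h1
      · exact Or.inl h1
      · refine Or.inr ⟨hrA h1, ?_⟩
        rcases lt_trichotomy z y with h2 | rfl | h2
        · exact h2
        · exact absurd hz (lt_irrefl _)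
        · exact absurd hz (h.lt_of_notMem y z (hrA h1).symm hy h2).asymm
      · exact absurd hz (h.lt_of_arrival y z h1).asymm
    · rintro (hz | ⟨hz, hzy⟩)
      · exact h.lt_of_arrival z y hz
      · exact h.lt_of_notMem z y hz (hz ▸ hy) hzy
  · rw [Set.disjoint_left]
    rintro z (hz : rA (c z) < rA (c y)) ⟨hz' : c z = c y, -⟩
    exact hz.ne (congrArg rA hz')

/-- The flipped case: among the points with the label of `y`, those before `y` are exactly the ones
sent after `S y`. -/
lemma IsOrderedExchange.mass_Iic_apply (h : IsOrderedExchange F rA rD S c)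
    (hrA : Function.Injective rA) (hs : Summable m) {y : Y} (hy : c y ∈ F) :
    mass m (Iic (S y)) + mass (m ∘ S) ({z | c z = c y} ∩ Iio y) =
      mass (m ∘ S) {z | rA (c z) ≤ rA (c y)} := by
  rw [← mass_comp_equiv S, ← mass_union (S.summable_iff.2 hs)]
  · congr 1
    ext z
    simp only [mem_preimage, mem_Iic, mem_Iio, mem_union, mem_inter_iff, mem_ofPred_eq]
    constructor
    · rintro (hz | ⟨hz, hzy⟩)
      · by_contra! hlt
        exact absurd hz (not_le.2 (h.lt_of_arrival y z hlt))
      · rw [hz]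
    · intro hz
      rcases hz.lt_or_eq with h1 | h1
      · exact Or.inl (h.lt_of_arrival z y h1).le
      · rcases lt_trichotomy z y with h2 | rfl | h2
        · exact Or.inr ⟨hrA h1, h2⟩
        · exact Or.inl le_rfl
        · exact Or.inl (h.lt_of_mem y z (hrA h1).symm hy h2).le
  · rw [Set.disjoint_left]
    rintro z hz ⟨hz' : c z = c y, hzy⟩
    exact absurd hz (not_le.2 (h.lt_of_mem z y hz' (hz' ▸ hy) hzy))

/-- The interval of `y` lies in the interval of its label. -/
lemma IsOrderedExchange.Ioo_mass_subset (h : IsOrderedExchange F rA rD S c)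
    (hm : ∀ y, 0 < m y) (hs : Summable m) (y : Y) :
    Ioo (mass m (Iio y)) (mass m (Iic y)) ⊆
      Ioo (mass m {z | rD (c z) < rD (c y)}) (mass m {z | rD (c z) ≤ rD (c y)}) := by
  apply Ioo_subset_Ioo
  · exact mass_mono hm hs fun z hz => h.lt_of_departure z y hz
  · refine mass_mono hm hs fun z hz => ?_
    by_contra hlt
    exact absurd hz (not_le.2 (h.lt_of_departure y z (not_le.1 hlt)))

open Classical in
/-- The branch of the interval exchange on the interval of the letter `e`. -/
lemma IsOrderedExchange.exists_branch [Countable Y] (h : IsOrderedExchange F rA rD S c)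
    (hc : Function.Surjective c) (hrA : Function.Injective rA) (hrD : Function.Injective rD)
    (hm : ∀ y, 0 < m y) (h1 : HasSum m 1) (e : A) :
    ∃ H : ℝ → ℝ,
      ContinuousOn H (Ioo (mass m {z | rD (c z) < rD e}) (mass m {z | rD (c z) ≤ rD e})) ∧
      (e ∉ F → StrictMonoOn H
        (Ioo (mass m {z | rD (c z) < rD e}) (mass m {z | rD (c z) ≤ rD e}))) ∧
      (e ∈ F → StrictAntiOn H
        (Ioo (mass m {z | rD (c z) < rD e}) (mass m {z | rD (c z) ≤ rD e}))) ∧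
      H '' Ioo (mass m {z | rD (c z) < rD e}) (mass m {z | rD (c z) ≤ rD e}) =
        Ioo (mass (m ∘ S) {z | rA (c z) < rA e}) (mass (m ∘ S) {z | rA (c z) ≤ rA e}) ∧
      ∀ y, c y = e → ∀ t ∈ Ioo (0 : ℝ) 1, H (mass m (Iio y) + m y * t) =
        mass m (Iio (S y)) + m (S y) * if e ∈ F then 1 - t else t := by
  have hs := h1.summable
  have hs' : Summable (m ∘ S) := S.summable_iff.2 hs
  have hm' : ∀ y, 0 < (m ∘ S) y := fun y => hm (S y)
  set P : Set Y := {z | c z = e} with hP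
  set a := mass m {z | rD (c z) < rD e} with ha
  set b := mass m {z | rD (c z) ≤ rD e} with hb
  set G := stretch m (m ∘ S) P with hG
  have hab : a < b := mass_level_lt_mass_level_le hm hs hc hrD e
  have hcont : Continuous G := stretch_continuous hm' hs' P
  have hmono : StrictMonoOn G (Icc a b) := by
    intro x hx x' hx' hxx'
    have ha0 : 0 ≤ a := by
      rw [← mass_empty (m := m)]
      exact mass_mono hm hs (empty_subset _)
    have hb1 : b ≤ 1 := by
      rw [← h1.tsum_eq, ← mass_univ]
      exact mass_mono hm hs (subset_univ _)
    obtain ⟨y, p, hp, hpy⟩ :=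
      exists_mem_Ioo_mass hm h1 (ha0.trans hx.1) hxx' (hx'.2.trans hb1)
    refine stretch_lt hm hs hm' hs' (y := y) ?_ hp.1 hp.2 hpy
    by_contra hne
    exact Set.disjoint_left.1 (disjoint_level_intervals hm hs c hrD hne)
      (h.Ioo_mass_subset hm hs y hpy) ⟨hx.1.trans_lt hp.1, hp.2.trans_le hx'.2⟩
  have hGa : G a = 0 := stretch_eq_zero hm fun z (hz : c z = e) =>
    mass_mono hm hs fun w (hw : rD (c w) < rD e) => h.lt_of_departure w z (hz ▸ hw)
  have hGb : G b = mass (m ∘ S) P := by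
    refine stretch_eq_mass hm hs fun z (hz : c z = e) => mass_mono hm hs fun w hw => ?_
    by_contra hlt
    exact absurd hw (not_le.2 (h.lt_of_departure z w (hz ▸ not_le.1 hlt)))
  have himage : G '' Ioo a b = Ioo 0 (mass (m ∘ S) P) := by
    rw [← hGa, ← hGb]
    refine Subset.antisymm ?_ (intermediate_value_Ioo hab.le hcont.continuousOn)
    rintro _ ⟨x, hx, rfl⟩
    have hx' := Ioo_subset_Icc_self hx
    exact ⟨hmono (left_mem_Icc.2 hab.le) hx' hx.1, hmono hx' (right_mem_Icc.2 hab.le) hx.2⟩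
  have hlevel := mass_level_le hs' c hrA e
  by_cases he : e ∈ F
  · refine ⟨fun x => mass (m ∘ S) {z | rA (c z) ≤ rA e} - G x,
      (continuous_const.sub hcont).continuousOn, fun h => absurd he h,
      fun _ x hx x' hx' hxx' => sub_lt_sub_left
        (hmono (Ioo_subset_Icc_self hx) (Ioo_subset_Icc_self hx') hxx') _, ?_, ?_⟩
    · rw [← image_image (fun x => mass (m ∘ S) {z | rA (c z) ≤ rA e} - x) G, himage,
        image_const_sub_Ioo, sub_zero, hlevel, add_sub_cancel_right]
    · rintro y rfl t ht
      have hGt := stretch_add_mul (n := m ∘ S) hm hs hs' (show y ∈ P from rfl) ht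
      change mass (m ∘ S) {z | rA (c z) ≤ rA (c y)} - stretch m (m ∘ S) P _ = _
      rw [hGt, if_pos he,
        ← h.mass_Iic_apply hrA hs he, mass_Iic hs, Function.comp_apply]
      ring
  · refine ⟨fun x => mass (m ∘ S) {z | rA (c z) < rA e} + G x,
      (continuous_const.add hcont).continuousOn,
      fun _ x hx x' hx' hxx' => add_lt_add_right
        (hmono (Ioo_subset_Icc_self hx) (Ioo_subset_Icc_self hx') hxx') _,
      fun h => absurd h he, ?_, ?_⟩
    · rw [← image_image (fun x => mass (m ∘ S) {z | rA (c z) < rA e} + x) G, himage,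
        image_const_add_Ioo, add_zero, hlevel]
    · rintro y rfl t ht
      have hGt := stretch_add_mul (n := m ∘ S) hm hs hs' (show y ∈ P from rfl) ht
      change mass (m ∘ S) {z | rA (c z) < rA (c y)} + stretch m (m ∘ S) P _ = _
      rw [hGt, if_neg he,
        h.mass_Iio_apply hrA hs he, Function.comp_apply, add_assoc]

lemma exists_pos_hasSum_one (Y : Type*) [Countable Y] [Nonempty Y] :
    ∃ m : Y → ℝ, (∀ y, 0 < m y) ∧ HasSum m 1 := by
  have := Encodable.ofCountable Y
  obtain ⟨ε, hε, s, hs, -⟩ := posSumOfEncodable one_pos Y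
  have hpos : 0 < s := by
    rw [← hs.tsum_eq]
    exact hs.summable.tsum_pos (fun y => (hε y).le) (Classical.arbitrary Y) (hε _)
  exact ⟨fun y => ε y / s, fun y => div_pos (hε y) hpos, by
    simpa [div_self hpos.ne'] using hs.div_const s⟩

/-- Functions given on pairwise disjoint sets can be glued. -/
lemma exists_eqOn_of_pairwise_disjoint {I : A → Set ℝ}
    (hI : Pairwise fun e f : A => Disjoint (I e) (I f)) (H : A → ℝ → ℝ) :
    ∃ T : ℝ → ℝ, ∀ e, EqOn T (H e) (I e) := by
  classical
  refine ⟨fun x => if h : ∃ e, x ∈ I e then H h.choose x else 0, fun e x hx => ?_⟩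
  have h : ∃ e, x ∈ I e := ⟨e, hx⟩
  have he : h.choose = e := by
    by_contra hne
    exact Set.disjoint_left.1 (hI hne) h.choose_spec hx
  simp only [dif_pos h, he]

/-- The points at which the orbit of `T` is defined and follows the word `w` form an open set. -/
lemma GenIET.exists_isOpen_follow (T : GenIET F) (w : List A) :
    ∃ C : Set ℝ, IsOpen C ∧ ∀ x, x ∈ C ↔
      ∀ (i : ℕ) (hi : i < w.length), T.toFun^[i] x ∈ T.interval w[i] := by
  induction w with
  | nil => exact ⟨univ, isOpen_univ, by simp⟩
  | cons a w ih =>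
    obtain ⟨C, hC, hmem⟩ := ih
    refine ⟨T.interval a ∩ T.toFun ⁻¹' C,
      (T.continuousOn a).isOpen_inter_preimage isOpen_Ioo hC, fun x => ?_⟩
    rw [mem_inter_iff, mem_preimage, hmem]
    constructor
    · rintro ⟨h0, hs⟩ i hi
      cases i with
      | zero => exact h0
      | succ i => exact hs i (by simpa using hi)
    · intro h
      exact ⟨h 0 (by simp), fun i hi => h (i + 1) (by simpa using hi)⟩

/-- Each point of `Y` is blown up to an interval, with lengths of sum `1`. The intervals are dense
and permuted by the interval exchange, so that its trajectories have no other factors than those of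
the orbits in `Y`. -/
theorem IsOrderedExchange.exists_genIET [Finite A] [Countable Y] [Nonempty Y]
    (h : IsOrderedExchange F rA rD S c) (hc : Function.Surjective c)
    (hrA : Function.Injective rA) (hrD : Function.Injective rD) :
    ∃ T : GenIET F, ∀ w : List A,
      w ∈ T.naturalCoding ↔ ∃ y, IsFactor w (fun n : ℤ => c ((S ^ n) y)) := by
  classical
  obtain ⟨m, hm, h1⟩ := exists_pos_hasSum_one Y
  have hs := h1.summable
  have h1' : HasSum (m ∘ S) 1 := S.hasSum_iff.2 h1
  have hm' : ∀ y, 0 < (m ∘ S) y := fun y => hm (S y)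
  choose H hcont hmono hanti himage hval using h.exists_branch hc hrA hrD hm h1
  have hdisj := disjoint_level_intervals hm hs c hrD
  obtain ⟨f, hf⟩ := exists_eqOn_of_pairwise_disjoint hdisj H
  have hfimage := fun e => (hf e).image_eq.trans (himage e)
  let T : GenIET F :=
    { toFun := f
      left := fun e => mass m {z | rD (c z) < rD e}
      right := fun e => mass m {z | rD (c z) ≤ rD e}
      left_lt_right := mass_level_lt_mass_level_le hm hs hc hrD
      disjoint_intervals := hdisj
      iUnion_closure := iUnion_level_intervals hm h1 hc hrD
      continuousOn := fun e => (hcont e).congr (hf e)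
      strictMonoOn := fun e he => (hmono e he).congr (hf e).symm
      strictAntiOn := fun e he => (hanti e he).congr (hf e).symm
      image_interval := fun e => ⟨_, _, hfimage e⟩
      disjoint_images := by
        simp only [hfimage]
        exact disjoint_level_intervals hm' h1'.summable c hrA
      iUnion_closure_image := by
        simp only [hfimage]
        exact iUnion_level_intervals hm' h1' hc hrA }
  have hsub : ∀ y, Ioo (mass m (Iio y)) (mass m (Iic y)) ⊆ T.interval (c y) :=
    h.Ioo_mass_subset hm hs
  have hfval : ∀ y, ∀ t ∈ Ioo (0 : ℝ) 1, f (mass m (Iio y) + m y * t) =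
      mass m (Iio (S y)) + m (S y) * if c y ∈ F then 1 - t else t := fun y t ht =>
    (hf (c y) (hsub y ((mem_Ioo_mass_iff hm hs).2 ⟨t, ht, rfl⟩))).trans (hval (c y) y rfl t ht)
  have hmaps : ∀ y, MapsTo f (Ioo (mass m (Iio y)) (mass m (Iic y)))
      (Ioo (mass m (Iio (S y))) (mass m (Iic (S y)))) := by
    intro y x hx
    obtain ⟨t, ht, rfl⟩ := (mem_Ioo_mass_iff hm hs).1 hx
    refine (mem_Ioo_mass_iff hm hs).2 ⟨_, ?_, hfval y t ht⟩
    split_ifs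
    · exact ⟨by linarith [ht.2], by linarith [ht.1]⟩
    · exact ht
  refine ⟨T, fun w => ⟨?_, ?_⟩⟩
  · rintro ⟨u, ⟨x, hx⟩, k, hk⟩
    obtain ⟨C, hC, hmem⟩ := T.exists_isOpen_follow w
    have hxC : x k ∈ C := by
      rw [hmem]
      have : ∀ i : ℕ, T.toFun^[i] (x k) = x (k + i) := by
        intro i
        induction i with
        | zero => simp
        | succ i ih =>
          rw [Function.iterate_succ_apply', ih, ← (hx _).2]
          congr 1
          push_cast
          ring
      intro i hi
      rw [this, hk i hi]
      exact (hx _).1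
    -- A small interval around `x k` inside `C` and `[0, 1]` meets the interval of some `y`.
    have hx0 := (hx k).1
    have hopen : IsOpen (C ∩ T.interval (u k)) := hC.inter isOpen_Ioo
    obtain ⟨p, q, ⟨hp, hq⟩, hpq⟩ :=
      mem_nhds_iff_exists_Ioo_subset.1 (hopen.mem_nhds ⟨hxC, hx0⟩)
    have hIcc : Icc p q ⊆ Icc 0 1 := by
      rw [← closure_Ioo (hp.trans hq).ne, ← T.iUnion_closure]
      exact (closure_mono (hpq.trans inter_subset_right)).trans
        (subset_iUnion (fun e => closure (Ioo (T.left e) (T.right e))) (u k))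
    obtain ⟨y, z, hz, hzy⟩ := exists_mem_Ioo_mass hm h1
      (hIcc (left_mem_Icc.2 (hp.trans hq).le)).1 (hp.trans hq)
      (hIcc (right_mem_Icc.2 (hp.trans hq).le)).2
    have hzC := (hmem z).1 (hpq hz).1
    have horb : ∀ i : ℕ, T.toFun^[i] z ∈
        Ioo (mass m (Iio ((S ^ i) y))) (mass m (Iic ((S ^ i) y))) := by
      intro i
      induction i with
      | zero => exact hzy
      | succ i ih =>
        rw [Function.iterate_succ_apply', pow_succ', Equiv.Perm.mul_apply]
        exact hmaps _ ih
    refine ⟨y, 0, fun i hi => ?_⟩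
    change w[i] = c ((S ^ (0 + (i : ℤ))) y)
    rw [zero_add, zpow_natCast]
    by_contra hne
    exact Set.disjoint_left.1 (hdisj hne) (hzC i hi) (hsub _ (horb i))
  · rintro ⟨y, hy⟩
    refine ⟨_, ⟨fun n => mass m (Iio ((S ^ n) y)) + m ((S ^ n) y) * (1 / 2), fun n => ?_⟩, hy⟩
    have hhalf : (1 / 2 : ℝ) ∈ Ioo (0 : ℝ) 1 := by norm_num
    refine ⟨hsub _ ((mem_Ioo_mass_iff hm hs).2 ⟨_, hhalf, rfl⟩), ?_⟩
    refine Eq.trans ?_ (hfval _ _ hhalf).symm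
    rw [← Equiv.Perm.mul_apply, ← zpow_one_add, add_comm 1 n]
    split_ifs <;> norm_num

end Realization


/-! ### Two-sided sequences with factors in a language -/

section Language

variable {A : Type*} {L : Language A}

lemma IsFactorialExtendable.of_append_right (hL : IsFactorialExtendable L) (s t : List A)
    (h : s ++ t ∈ L) : t ∈ L := by
  induction s with
  | nil => exact h
  | cons a s ih => exact ih (hL.tail_mem a _ h)

lemma IsFactorialExtendable.of_append_left (hL : IsFactorialExtendable L) (s t : List A)
    (h : s ++ t ∈ L) : s ∈ L := by
  induction t using List.reverseRecOn with
  | nil => simpa using h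
  | append_singleton t a ih => exact ih (hL.init_mem _ a (by simpa using h))

lemma IsFactorialExtendable.of_infix (hL : IsFactorialExtendable L) {v w : List A}
    (h : v <:+: w) (hw : w ∈ L) : v ∈ L := by
  obtain ⟨s, t, rfl⟩ := h
  exact hL.of_append_right s v (hL.of_append_left _ t hw)

/-- The sequence is the limit of the words obtained from `w` by repeatedly extending it by one
letter on each side; in the `n`-th word, the letter of the sequence of index `k` is at
position `k + n`. -/
lemma IsFactorialExtendable.exists_sequence (hL : IsFactorialExtendable L) {w : List A}
    (hw : w ∈ L) : ∃ u : ℤ → A, (∀ v, IsFactor v u → v ∈ L) ∧ IsFactor w u := by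
  have hext : ∀ v : {v // v ∈ L}, ∃ a b, a :: (v.1 ++ [b]) ∈ L := by
    intro v
    obtain ⟨b, hb⟩ := hL.extend_right v.1 v.2
    obtain ⟨a, ha⟩ := hL.extend_left _ hb
    exact ⟨a, b, ha⟩
  choose a b hab using hext
  let step : {v // v ∈ L} → {v // v ∈ L} := fun v => ⟨a v :: (v.1 ++ [b v]), hab v⟩
  let V : ℕ → {v // v ∈ L} := fun n => step^[n] ⟨w, hw⟩
  have hV : ∀ n, (V (n + 1)).1 = a (V n) :: ((V n).1 ++ [b (V n)]) := fun n => by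
    simp only [V, Function.iterate_succ_apply', step]
  have hlen : ∀ n, (V n).1.length = w.length + 2 * n := by
    intro n
    induction n with
    | zero => rfl
    | succ n ih => rw [hV, List.length_cons, List.length_append, ih, List.length_singleton]; ring
  have hget : ∀ n i, i < (V n).1.length → (V (n + 1)).1[i + 1]? = (V n).1[i]? := fun n i hi => by
    rw [hV, List.getElem?_cons_succ, List.getElem?_append_left hi]
  have hu : ∀ k : ℤ, ∃ x, ∀ n : ℕ, k.natAbs + 1 ≤ n → (V n).1[(k + n).toNat]? = some x := by
    intro k
    have hk : (k + (k.natAbs + 1 : ℕ)).toNat < (V (k.natAbs + 1)).1.length := by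
      rw [hlen]; omega
    refine ⟨(V (k.natAbs + 1)).1[(k + (k.natAbs + 1 : ℕ)).toNat], fun n hn => ?_⟩
    induction n, hn using Nat.le_induction with
    | base => exact List.getElem?_eq_getElem hk
    | succ n hn ih =>
      have h1 : (k + (n + 1 : ℕ)).toNat = (k + n).toNat + 1 := by omega
      rw [h1, hget n _ (by rw [hlen]; omega), ih]
  choose u hu using hu
  refine ⟨u, ?_, 0, ?_⟩
  · rintro v ⟨k, hv⟩
    set n := k.natAbs + v.length + 1 with hn
    refine hL.of_infix (w := (V n).1) ?_ (V n).2
    rw [List.infix_iff_getElem?]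
    refine ⟨(k + n).toNat, ?_, fun i hi => ?_⟩
    · rw [hlen]; omega
    · have h1 : i + (k + n).toNat = (k + i + n).toNat := by omega
      rw [h1, hu (k + i) n (by omega), hv i hi]
  · intro i hi
    have hbase : ∀ n, (V n).1[i + n]? = some w[i] := by
      intro n
      induction n with
      | zero => exact List.getElem?_eq_getElem hi
      | succ n ih => rw [← add_assoc, hget n _ (by rw [hlen]; omega), ih]
    have h1 := hu i (i + 1) (by simp)
    have h2 : ((i : ℤ) + (i + 1 : ℕ)).toNat = i + (i + 1) := by omega
    rw [h2, hbase] at h1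
    rw [zero_add]
    exact Option.some.inj h1

end Language

/-! ### The order on two-sided sequences -/

section Order

variable {A : Type*}

open Classical in
/-- The sign of a letter: `-1` if it is flipped, `1` otherwise. -/
noncomputable def flipSign (F : Set A) (a : A) : ℤ := if a ∈ F then -1 else 1

/-- The rank of the letter `u i`, for `0 ≤ i`, with a sign given by the flips between `0` and `i`.
-/
noncomputable def futureKey (F : Set A) (rD : A → ℤ) (u : ℤ → A) (i : ℕ) : ℤ :=
  (∏ j ∈ Finset.range i, flipSign F (u j)) * rD (u i)

/-- The rank of the letter `u (-1 - i)`, for `0 ≤ i`, with a sign given by the flips between this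
letter and the origin. -/
noncomputable def pastKey (F : Set A) (rA : A → ℤ) (u : ℤ → A) (i : ℕ) : ℤ :=
  (∏ j ∈ Finset.range i, flipSign F (u (-1 - j))) * rA (u (-1 - i))

/-- The signed lexicographic order on two-sided sequences: the futures are compared first, and the
pasts if the futures are equal. -/
def SeqLT (F : Set A) (rA rD : A → ℤ) (u v : ℤ → A) : Prop :=
  (∃ n : ℕ, (∀ i : ℕ, i < n → u i = v i) ∧ futureKey F rD u n < futureKey F rD v n) ∨
  ((∀ i : ℕ, u i = v i) ∧ ∃ n : ℕ, (∀ i : ℕ, i < n → u (-1 - i) = v (-1 - i)) ∧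
    pastKey F rA u n < pastKey F rA v n)

/-- The shift on two-sided sequences. -/
def seqShift (u : ℤ → A) : ℤ → A := fun n => u (n + 1)

variable {F : Set A} {rA rD : A → ℤ}

lemma flipSign_eq (a : A) : flipSign F a = 1 ∨ flipSign F a = -1 := by
  unfold flipSign
  split_ifs <;> simp

lemma abs_prod_flipSign (n : ℕ) (f : ℕ → A) :
    |∏ j ∈ Finset.range n, flipSign F (f j)| = 1 := by
  rw [Finset.abs_prod]
  refine Finset.prod_eq_one fun j _ => ?_
  rcases flipSign_eq (F := F) (f j) with h | h <;> simp [h]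

/-- As the ranks are positive, the absolute value of the key determines the letter. -/
lemma eq_of_futureKey_eq (hpos : ∀ a, 0 < rD a) (hr : Function.Injective rD) {u v : ℤ → A} {i : ℕ}
    (h : futureKey F rD u i = futureKey F rD v i) : u i = v i := by
  have h' := congrArg abs h
  rw [futureKey, futureKey, abs_mul, abs_mul, abs_prod_flipSign, abs_prod_flipSign, one_mul,
    one_mul, abs_of_pos (hpos _), abs_of_pos (hpos _)] at h'
  exact hr h'

lemma eq_of_pastKey_eq (hpos : ∀ a, 0 < rA a) (hr : Function.Injective rA) {u v : ℤ → A} {i : ℕ}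
    (h : pastKey F rA u i = pastKey F rA v i) : u (-1 - i) = v (-1 - i) := by
  have h' := congrArg abs h
  rw [pastKey, pastKey, abs_mul, abs_mul, abs_prod_flipSign, abs_prod_flipSign, one_mul,
    one_mul, abs_of_pos (hpos _), abs_of_pos (hpos _)] at h'
  exact hr h'

lemma futureKey_congr {u v : ℤ → A} {i : ℕ} (h : ∀ j : ℕ, j ≤ i → u j = v j) :
    futureKey F rD u i = futureKey F rD v i := by
  unfold futureKey
  rw [h i le_rfl, Finset.prod_congr rfl fun j hj => by rw [h j (Finset.mem_range.1 hj).le]]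

lemma pastKey_congr {u v : ℤ → A} {i : ℕ} (h : ∀ j : ℕ, j ≤ i → u (-1 - j) = v (-1 - j)) :
    pastKey F rA u i = pastKey F rA v i := by
  unfold pastKey
  rw [h i le_rfl, Finset.prod_congr rfl fun j hj => by rw [h j (Finset.mem_range.1 hj).le]]

/-- `SeqLT` is pulled back from a lexicographic product by the injective map given by the keys. -/
lemma exists_linearOrder_seqLT (hposA : ∀ a, 0 < rA a) (hrA : Function.Injective rA)
    (hposD : ∀ a, 0 < rD a) (hrD : Function.Injective rD) :
    ∃ o : LinearOrder (ℤ → A), ∀ u v, o.lt u v ↔ SeqLT F rA rD u v := by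
  let K : (ℤ → A) → Lex (Lex (ℕ → ℤ) × Lex (ℕ → ℤ)) := fun u =>
    toLex (toLex (futureKey F rD u), toLex (pastKey F rA u))
  have hK : Function.Injective K := by
    intro u v huv
    have huv' : (toLex (futureKey F rD u), toLex (pastKey F rA u)) =
        (toLex (futureKey F rD v), toLex (pastKey F rA v)) := toLex.injective huv
    have h1 : futureKey F rD u = futureKey F rD v := toLex.injective (congrArg Prod.fst huv')
    have h2 : pastKey F rA u = pastKey F rA v := toLex.injective (congrArg Prod.snd huv')
    funext k
    rcases le_or_gt 0 k with hk | hk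
    · obtain ⟨n, rfl⟩ := Int.eq_ofNat_of_zero_le hk
      exact eq_of_futureKey_eq hposD hrD (congrFun h1 n)
    · obtain ⟨n, hn⟩ := Int.eq_ofNat_of_zero_le (show 0 ≤ -1 - k by omega)
      have : k = -1 - n := by omega
      rw [this]
      exact eq_of_pastKey_eq hposA hrA (congrFun h2 n)
  refine ⟨LinearOrder.lift' K hK, fun u v => ?_⟩
  change K u < K v ↔ _
  rw [Prod.Lex.toLex_lt_toLex]
  refine or_congr ?_ (and_congr ?_ ?_)
  · change (∃ n, (∀ i, i < n → futureKey F rD u i = futureKey F rD v i) ∧ _) ↔ _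
    refine exists_congr fun n => and_congr_left fun _ => ⟨fun h i hi =>
      eq_of_futureKey_eq hposD hrD (h i hi), fun h i hi => futureKey_congr fun j hj =>
        h j (hj.trans_lt hi)⟩
  · refine ⟨fun h i => eq_of_futureKey_eq hposD hrD (congrFun (toLex.injective h) i), fun h => ?_⟩
    exact congrArg toLex (funext fun i => futureKey_congr fun j _ => h j)
  · change (∃ n, (∀ i, i < n → pastKey F rA u i = pastKey F rA v i) ∧ _) ↔ _
    refine exists_congr fun n => and_congr_left fun _ => ⟨fun h i hi =>
      eq_of_pastKey_eq hposA hrA (h i hi), fun h i hi => pastKey_congr fun j hj =>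
        h j (hj.trans_lt hi)⟩

lemma futureKey_succ (u : ℤ → A) (i : ℕ) :
    futureKey F rD u (i + 1) = flipSign F (u 0) * futureKey F rD (seqShift u) i := by
  simp only [futureKey, seqShift, Finset.prod_range_succ', Nat.cast_add, Nat.cast_one,
    Nat.cast_zero]
  ring

lemma seqShift_neg_succ (u : ℤ → A) (i : ℕ) : seqShift u (-1 - (i + 1 : ℕ)) = u (-1 - i) := by
  unfold seqShift
  congr 1
  push_cast
  ring

lemma seqShift_neg_zero (u : ℤ → A) : seqShift u (-1 - (0 : ℕ)) = u 0 := by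
  simp [seqShift]

lemma pastKey_seqShift_succ (u : ℤ → A) (i : ℕ) :
    pastKey F rA (seqShift u) (i + 1) = flipSign F (u 0) * pastKey F rA u i := by
  simp only [pastKey, Finset.prod_range_succ', seqShift_neg_succ, seqShift_neg_zero]
  ring

/-- The shift preserves or reverses the order of sequences with the same letter at the origin,
according to the sign of this letter. -/
lemma SeqLT.seqShift_of_eq {u v : ℤ → A} (h0 : u 0 = v 0) (h : SeqLT F rA rD u v) :
    (u 0 ∉ F → SeqLT F rA rD (seqShift u) (seqShift v)) ∧
    (u 0 ∈ F → SeqLT F rA rD (seqShift v) (seqShift u)) := by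
  rcases h with ⟨n, hn, hlt⟩ | ⟨hf, n, hn, hlt⟩
  · cases n with
    | zero => simp [futureKey, h0] at hlt
    | succ n =>
      have hn' : ∀ i : ℕ, i < n → seqShift u i = seqShift v i := fun i hi => by
        have := hn (i + 1) (by omega)
        push_cast at this
        exact this
      rw [futureKey_succ, futureKey_succ, ← h0] at hlt
      constructor
      · intro he
        exact Or.inl ⟨n, hn', by simpa [flipSign, he] using hlt⟩
      · intro he
        exact Or.inl ⟨n, fun i hi => (hn' i hi).symm, by simpa [flipSign, he] using hlt⟩
  · have hf' : ∀ i : ℕ, seqShift u i = seqShift v i := fun i => by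
      have := hf (i + 1)
      push_cast at this
      exact this
    have hn' : ∀ i : ℕ, i < n + 1 → seqShift u (-1 - i) = seqShift v (-1 - i) := by
      intro i hi
      cases i with
      | zero => rw [seqShift_neg_zero, seqShift_neg_zero, h0]
      | succ i => rw [seqShift_neg_succ, seqShift_neg_succ, hn i (by omega)]
    have e1 := pastKey_seqShift_succ (F := F) (rA := rA) u n
    have e2 := pastKey_seqShift_succ (F := F) (rA := rA) v n
    rw [← h0] at e2
    constructor
    · intro he
      refine Or.inr ⟨hf', n + 1, hn', ?_⟩
      rw [e1, e2]
      simpa [flipSign, he] using hlt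
    · intro he
      refine Or.inr ⟨fun i => (hf' i).symm, n + 1, fun i hi => (hn' i hi).symm, ?_⟩
      rw [e1, e2]
      simpa [flipSign, he] using hlt

lemma prod_map_flipSign (w : List A) : (w.map (flipSign F)).prod = (-1) ^ flipCount F w := by
  induction w with
  | nil => simp [flipCount]
  | cons a w ih =>
    rw [List.map_cons, List.prod_cons, ih, flipCount_cons]
    by_cases ha : a ∈ F <;> simp [flipSign, ha, pow_succ]

lemma departureOrder_iff {ltD : A → A → Prop} (hD : ∀ a b, ltD a b ↔ rD a < rD b) (w : List A)
    (c d : A) : departureOrder F ltD w c d ↔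
      (w.map (flipSign F)).prod * rD c < (w.map (flipSign F)).prod * rD d := by
  rw [prod_map_flipSign, departureOrder]
  split_ifs with h
  · simp [hD, h.neg_one_pow]
  · simp [hD, (Nat.not_even_iff_odd.1 h).neg_one_pow]

lemma prod_map_range (f : ℕ → A) (n : ℕ) :
    (((List.range n).map f).map (flipSign F)).prod = ∏ j ∈ Finset.range n, flipSign F (f j) := by
  induction n with
  | zero => simp
  | succ n ih => simp [List.range_succ, Finset.prod_range_succ, ← ih]

/-- If the shifted sequences have different futures, with longest common prefix `w`, then the order
condition for `w` shows that the comparison of the futures agrees with that of the letters before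
`w`. -/
lemma seqLT_seqShift_of_arrival {L : Language A} (hL : IsFactorialExtendable L)
    {ltA ltD : A → A → Prop} (hA : ∀ a b, ltA a b ↔ rA a < rA b)
    (hD : ∀ a b, ltD a b ↔ rD a < rD b)
    (hord : ∀ w, IsBispecial L w → OrderConditionAt L w ltA (departureOrder F ltD w))
    {u v : ℤ → A} (hu : ∀ w, IsFactor w u → w ∈ L) (hv : ∀ w, IsFactor w v → w ∈ L)
    (h : rA (u 0) < rA (v 0)) : SeqLT F rA rD (seqShift u) (seqShift v) := by
  classical
  have h0 : u 0 ≠ v 0 := fun h' => h.ne (congrArg rA h')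
  by_cases hf : ∀ i : ℕ, seqShift u i = seqShift v i
  · refine Or.inr ⟨hf, 0, by simp, ?_⟩
    simpa only [pastKey, Finset.range_zero, Finset.prod_empty, one_mul, seqShift_neg_zero] using h
  · push Not at hf
    have hne := Nat.find_spec hf
    have hmin := fun (i : ℕ) (hi : i < Nat.find hf) => not_not.1 (Nat.find_min hf hi)
    set n := Nat.find hf
    have hfac : ∀ x : ℤ → A, IsFactor
        (x 0 :: ((List.range n).map (fun i : ℕ => seqShift x i) ++ [seqShift x n])) x := by
      intro x
      refine ⟨0, fun i hi => ?_⟩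
      cases i with
      | zero => simp
      | succ i =>
        have hi' : i < n + 1 := by simpa using hi
        rw [List.getElem_cons_succ]
        rcases (Nat.lt_succ_iff.1 hi').lt_or_eq with h1 | rfl
        · rw [List.getElem_append_left (by simpa using h1)]
          simp [seqShift]
        · rw [List.getElem_append_right (by simp)]
          simp [seqShift]
    have hwu := hu _ (hfac u)
    have hwv := hv _ (hfac v)
    have hw : (List.range n).map (fun i : ℕ => seqShift v i) =
        (List.range n).map (fun i : ℕ => seqShift u i) :=
      List.map_congr_left fun i hi => (hmin i (List.mem_range.1 hi)).symm
    rw [hw] at hwv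
    set w := (List.range n).map (fun i : ℕ => seqShift u i) with hw_def
    have hbi : IsBispecial L w := by
      refine ⟨hL.init_mem _ _ (hL.tail_mem _ _ hwu), ⟨u 0, ?_, v 0, ?_, h0⟩,
        ⟨seqShift u n, ?_, seqShift v n, ?_, hne⟩⟩
      · exact hL.init_mem (u 0 :: w) _ hwu
      · exact hL.init_mem (v 0 :: w) _ hwv
      · exact hL.tail_mem _ _ hwu
      · exact hL.tail_mem _ _ hwv
    have hlt := (hord w hbi _ _ _ _ h0 hne hwu hwv).1 ((hA _ _).2 h)
    rw [departureOrder_iff hD, hw_def, prod_map_range] at hlt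
    refine Or.inl ⟨n, hmin, hlt.trans_eq ?_⟩
    rw [futureKey, Finset.prod_congr rfl fun j hj => by rw [hmin j (Finset.mem_range.1 hj)]]

/-- A strict total order on a finite type is pulled back from `ℤ` by positive ranks; positivity
makes a rank recoverable from its signed value. -/
lemma exists_rank [Finite A] (lt : A → A → Prop) [IsStrictTotalOrder A lt] :
    ∃ r : A → ℤ, (∀ a, 0 < r a) ∧ Function.Injective r ∧ ∀ a b, lt a b ↔ r a < r b := by
  classical
  let _ := linearOrderOfSTO lt
  have hfin : ∀ a : A, (Iic a).Finite := fun a => toFinite _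
  have hmono : StrictMono fun a : A => ((Iic a).ncard : ℤ) := fun a b hab =>
    Nat.cast_lt.2 (ncard_lt_ncard (Iic_ssubset_Iic.2 hab) (hfin b))
  exact ⟨_, fun a => Nat.cast_pos.2 ((ncard_pos (hfin a)).2 ⟨a, mem_Iic.2 le_rfl⟩), hmono.injective,
    fun a b => hmono.lt_iff_lt.symm⟩

end Order

/-- The points to be realized are countably many two-sided sequences containing all words of `L`,
together with their shifts. -/
theorem FlippedOrderCondition.exists_genIET {A : Type*} [Finite A] {F : Set A} {L : Language A}
    (hL : IsFactorialExtendable L) (hA : ∀ a : A, [a] ∈ L) (h : FlippedOrderCondition F L) :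
    ∃ T : GenIET F, T.naturalCoding = L := by
  obtain ⟨ltA, ltD, hltA, hltD, hord⟩ := h
  obtain ⟨rA, hposA, hrA, hA'⟩ := exists_rank ltA
  obtain ⟨rD, hposD, hrD, hD'⟩ := exists_rank ltD
  obtain ⟨o, ho⟩ := exists_linearOrder_seqLT (F := F) hposA hrA hposD hrD
  choose x hxL hxw using fun w : {w // w ∈ L} => hL.exists_sequence w.2
  let Y : Set (ℤ → A) := range fun p : {w // w ∈ L} × ℤ => fun n => x p.1 (n + p.2)
  have hadd : ∀ u ∈ Y, ∀ k : ℤ, (fun n => u (n + k)) ∈ Y := by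
    rintro _ ⟨⟨w, j⟩, rfl⟩ k
    exact ⟨(w, k + j), by simp only [add_assoc]⟩
  have hYL : ∀ u ∈ Y, ∀ v, IsFactor v u → v ∈ L := by
    rintro _ ⟨⟨w, j⟩, rfl⟩ v ⟨k, hk⟩
    exact hxL w v ⟨k + j, fun i hi => by
      rw [hk i hi]
      change x w (k + i + j) = x w (k + j + i)
      congr 1
      ring⟩
  have hYw : ∀ w (hw : w ∈ L), x ⟨w, hw⟩ ∈ Y := fun w hw => ⟨(⟨w, hw⟩, 0), by simp⟩
  have hcount : Countable Y := by
    have : Countable (List A) := inferInstance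
    exact (countable_range _).to_subtype
  have hnonempty : Nonempty Y := ⟨⟨_, hYw [] hL.nil_mem⟩⟩
  let S : Equiv.Perm Y :=
    { toFun := fun y => ⟨seqShift y.1, hadd y.1 y.2 1⟩
      invFun := fun y => ⟨fun n => y.1 (n + -1), hadd y.1 y.2 (-1)⟩
      left_inv := fun y => Subtype.ext (funext fun n => by simp [seqShift])
      right_inv := fun y => Subtype.ext (funext fun n => by simp [seqShift]) }
  have hS : ∀ y : Y, (S y).1 = seqShift y.1 := fun _ => rfl
  have hSinv : ∀ (y : Y) (n : ℤ), (S⁻¹ y).1 n = y.1 (n + -1) := fun _ _ => rfl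
  have hpow : ∀ (n : ℤ) (y : Y) (j : ℤ), ((S ^ n) y).1 j = y.1 (j + n) := by
    intro n
    induction n using Int.induction_on with
    | zero => intro y j; simp
    | succ n ih =>
      intro y j
      rw [zpow_add_one, Equiv.Perm.mul_apply, ih, hS]
      simp only [seqShift, add_assoc]
    | pred n ih =>
      intro y j
      rw [zpow_sub_one, Equiv.Perm.mul_apply, ih, hSinv, sub_eq_add_neg, add_assoc]
  let c : Y → A := fun y => y.1 0
  have hc : Function.Surjective c := by
    intro a
    obtain ⟨k, hk⟩ := hxw ⟨[a], hA a⟩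
    refine ⟨⟨_, hadd _ (hYw [a] (hA a)) k⟩, ?_⟩
    have := hk 0 (by simp)
    simpa [c] using this.symm
  have hex : IsOrderedExchange F rA rD S c :=
    { lt_of_departure := fun y z hyz => (ho _ _).2 (Or.inl ⟨0, by simp, by
        simpa [futureKey] using hyz⟩)
      lt_of_arrival := fun y z hyz => (ho _ _).2
        (seqLT_seqShift_of_arrival hL hA' hD' hord (hYL _ y.2) (hYL _ z.2) hyz)
      lt_of_notMem := fun y z hyz hF hlt =>
        (ho _ _).2 ((((ho _ _).1 hlt).seqShift_of_eq hyz).1 hF)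
      lt_of_mem := fun y z hyz hF hlt =>
        (ho _ _).2 ((((ho _ _).1 hlt).seqShift_of_eq hyz).2 hF) }
  obtain ⟨T, hT⟩ := hex.exists_genIET hc hrA hrD
  refine ⟨T, Set.ext fun w => (hT w).trans ?_⟩
  have hcode : ∀ y : Y, (fun n : ℤ => c ((S ^ n) y)) = y.1 := fun y => funext fun n => by
    simp only [c, hpow, zero_add]
  simp only [hcode]
  exact ⟨fun ⟨y, hy⟩ => hYL y.1 y.2 w hy, fun hw => ⟨⟨_, hYw w hw⟩, hxw ⟨w, hw⟩⟩⟩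

end IET

theorem theorem4p4 {A : Type*} [Finite A] (F : Set A) (L : Language A)
    (hL : IET.IsFactorialExtendable L) (hA : ∀ a : A, [a] ∈ L) :
    (∃ T : IET.GenIET F, T.naturalCoding = L) ↔ IET.FlippedOrderCondition F L :=
  ⟨fun ⟨T, hT⟩ => hT ▸ T.flippedOrderCondition, fun h => h.exists_genIET hL hA⟩
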